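/- Let $a\ge 2$ be a fixed integer. For a positive integer $n$ and a $2$-coloring $c$ of the integers in $[1,n]=\{1,\dots,n\}$ (with colors red $R$ and blue $B$), let $M_{a,n}(c)$ be the number of monochromatic triples $(x,y,x+ay)$, that is, of ordered pairs $(x,y)$ of positive integers with $x+ay\le n$ such that $x$, $y$ and $x+ay$ all have the same color (the case $x=y$ is allowed). Then, as $n\to\infty$, $$\min_{c}\,M_{a,n}(c)=\frac{n^2}{2a(a^2+2a+3)}+O(n),$$ where the minimum is over all $2$-colorings $c$ of $[1,n]$ and the implied constant may depend on $a$. Moreover, this value is attained up to $O(n)$ by coloring $[1,n]$ with three consecutive blocks $R,B,R$ whose lengths are, up to rounding, in the ratio $1:a+\frac1{a+1}:\frac1{a+1}$: if $c_0$ colors $k$ blue exactly when $\frac{(a+1)n}{a^2+2a+3}<k\le\frac{(a^2+2a+2)n}{a^2+2a+3}$, and red otherwise, then $$M_{a,n}(c_0)=\frac{n^2}{2a(a^2+2a+3)}+O(n).$$ -/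

import Mathlib

open Filter Asymptotics

/-- A 2-coloring of the integer interval `[1, n]`; `true` is red and `false` is blue. -/
abbrev TwoColoring (n : ℕ) : Type := ↥(Finset.Icc 1 n) → Bool

/-- The monochromatic triples `(x, y, z)` of elements of `[1, n]` with `z = x + a * y`
(the case `x = y` is allowed). -/
def monoTriples (a n : ℕ) (c : TwoColoring n) :
    Finset (↥(Finset.Icc 1 n) × ↥(Finset.Icc 1 n) × ↥(Finset.Icc 1 n)) :=
  Finset.univ.filter fun t =>
    (t.1 : ℕ) + a * (t.2.1 : ℕ) = (t.2.2 : ℕ) ∧ c t.1 = c t.2.1 ∧ c t.2.1 = c t.2.2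

/-- The minimum of the number of monochromatic triples `(x, y, x + a * y)` over all
2-colorings of `[1, n]`. -/
def minMonoTriples (a n : ℕ) : ℕ :=
  Finset.univ.inf' Finset.univ_nonempty fun c : TwoColoring n => (monoTriples a n c).card

/-- The coloring of `[1, n]` by three consecutive blocks red, blue, red whose lengths are
(up to rounding) in the ratio `1 : a + 1 / (a + 1) : 1 / (a + 1)`. As the three numbers add up to
`(a ^ 2 + 2 * a + 3) / (a + 1)`, the first block ends at `n * (a + 1) / (a ^ 2 + 2 * a + 3)` and
the second one at `n * (a ^ 2 + 2 * a + 2) / (a ^ 2 + 2 * a + 3)`. -/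
def redBlueRed (a n : ℕ) : TwoColoring n := fun k =>
  decide ((a ^ 2 + 2 * a + 3) * (k : ℕ) ≤ (a + 1) * n ∨
    (a ^ 2 + 2 * a + 2) * n < (a ^ 2 + 2 * a + 3) * (k : ℕ))

/-! Encode a coloring by f = ±1 with partial sums S; put m = ⌊n/a⌋, F = S(n), G = S(m), V(u) =
S(n-u) - S(u). For z = x + ay, the quantity 1 + f(x)f(y) + f(x)f(z) + f(y)f(z) is 4 on monochromatic
triples and 0 on the others. Summing it over x and y gives n²/(2a) + Σ f(x)f(x+ay) + FG + Σ
f(y)V(ay) up to O(n) (`configSum_eq`). The autocorrelation is at least F²/(2a) - n/2 by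
Cauchy–Schwarz over residue classes mod a (`sum_sq_le_residue`). Since V is odd about n/2, pairing y
with m+1-y controls the last sum by |V| (`sum_mul_middleSum_ge`), and |V(u)| falls below n-2u by
twice the number of minority signs in (u, n-u]. Bounding that number by ramps max(p-u, 0) and
max(q-u, 0) gives `configSum_ge`, with a free parameter v.

By symmetry G ≥ 0. If F ≤ 0, let p and q count the values +1 in [1,m] and (m,n]. In the critical
range, optimizing v leaves 2(s² + p² + q²) with n = s + (a+1)p + q up to O(1), and Cauchy–Schwarz
yields the constant (a+1)² + 2 = a² + 2a + 3. If F ≥ 0, cruder counts suffice. Equality asks for p :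
q : s = a+1 : 1 : 1; the monochromatic triples of the three-block coloring form three triangles of
exactly these sizes, which gives the upper bound. -/

/-- The sum of the first `t` values `f 1, …, f t`. -/
noncomputable def partialSum (f : ℕ → ℝ) (t : ℕ) : ℝ := ∑ k ∈ Finset.Ioc 0 t, f k

lemma partialSum_zero (f : ℕ → ℝ) : partialSum f 0 = 0 := by simp [partialSum]

lemma partialSum_neg (f : ℕ → ℝ) (t : ℕ) :
    partialSum (fun k => -f k) t = -partialSum f t := by
  simp [partialSum]

lemma partialSum_sub (f : ℕ → ℝ) {s t : ℕ} (h : s ≤ t) :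
    partialSum f t - partialSum f s = ∑ k ∈ Finset.Ioc s t, f k := by
  unfold partialSum
  rw [← Finset.sum_Ioc_consecutive f (Nat.zero_le s) h]
  ring

lemma abs_partialSum_sub_le {f : ℕ → ℝ} (hf : ∀ k, |f k| = 1) {s t : ℕ} (h : s ≤ t) :
    |partialSum f t - partialSum f s| ≤ (t : ℝ) - s := by
  rw [partialSum_sub f h]
  refine (Finset.abs_sum_le_sum_abs _ _).trans ?_
  simp [hf, Nat.cast_sub h]

/-! ### Riemann sums of positive parts -/

/-- First-order Taylor estimate for the square of the positive part. -/
lemma posPart_sq_taylor (t d : ℝ) :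
    |2 * d * max t 0 - (max (t + d) 0 ^ 2 - max t 0 ^ 2)| ≤ d ^ 2 := by
  rw [abs_le]
  rcases max_cases t 0 with ⟨h, h'⟩ | ⟨h, h'⟩ <;>
  rcases max_cases (t + d) 0 with ⟨k, k'⟩ | ⟨k, k'⟩ <;> rw [h, k] <;>
  constructor <;> nlinarith

/-- Riemann sums of the positive part along an arithmetic progression. -/
lemma abs_sum_posPart_sub_le (c d : ℝ) (m : ℕ) :
    |2 * d * ∑ y ∈ Finset.Ioc 0 m, max (c + d * y) 0 - (max (c + d * m) 0 ^ 2 - max c 0 ^ 2)|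
      ≤ m * d ^ 2 := by
  induction m with
  | zero => simp
  | succ m ih =>
    rw [Finset.sum_Ioc_succ_top (Nat.zero_le m)]
    -- Expanding backwards from the new endpoint makes the linear term the new summand.
    have h := posPart_sq_taylor (c + d * (m + 1 : ℕ)) (-d)
    have e : c + d * ((m + 1 : ℕ) : ℝ) + -d = c + d * m := by push_cast; ring
    rw [e] at h
    rw [abs_le] at *
    push_cast at *
    constructor <;> nlinarith [ih.1, ih.2, h.1, h.2]

/-- Sum of two ramps of height `v` at both ends of `[0, n]`, over the multiples of `a`. -/
noncomputable def rampSum (a n : ℕ) (v : ℝ) : ℝ :=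
  ∑ y ∈ Finset.Ioc 0 (n / a), (max (v - a * y) 0 + max (v - (n - a * y)) 0)

/-- Each of the two ramps has area v²/2 and is sampled at spacing a, so the sum is about v²/a. -/
lemma abs_rampSum_sub_le {a n : ℕ} (ha : 1 ≤ a) (hn : 1 ≤ n) {v : ℝ} (hv : 0 ≤ v) (hvn : v ≤ n) :
    |a * rampSum a n v - v ^ 2| ≤ 3 * a ^ 2 * n := by
  have hm : a * (n / a) ≤ n := Nat.mul_div_le n a
  have hm' : n < a * (n / a) + a := by
    simpa [Nat.mul_add] using Nat.lt_mul_div_succ n (show 0 < a by omega)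
  unfold rampSum
  generalize n / a = m at *
  have hmR : (a : ℝ) * m ≤ n := by exact_mod_cast hm
  have hmR' : (n : ℝ) ≤ a * m + a := by exact_mod_cast hm'.le
  have haR : (1 : ℝ) ≤ a := by exact_mod_cast ha
  have hnR : (1 : ℝ) ≤ n := by exact_mod_cast hn
  have h1 := abs_sum_posPart_sub_le v (-a) m
  have h2 := abs_sum_posPart_sub_le (v - n) a m
  have e1 : ∀ y : ℕ, v + -(a : ℝ) * y = v - a * y := fun y => by ring
  have e2 : ∀ y : ℕ, v - n + (a : ℝ) * y = v - (n - a * y) := fun y => by ring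
  simp only [e1, e2] at h1 h2
  rw [Finset.sum_add_distrib]
  rw [max_eq_left hv] at h1
  rw [max_eq_right (by linarith : v - n ≤ 0)] at h2
  set X := ∑ y ∈ Finset.Ioc 0 m, max (v - (a : ℝ) * y) 0
  set Y := ∑ y ∈ Finset.Ioc 0 m, max (v - (n - (a : ℝ) * y)) 0
  have b1 : max (v - a * m) 0 ^ 2 ≤ (a : ℝ) ^ 2 :=
    pow_le_pow_left₀ (le_max_right _ _) (max_le (by linarith) (by linarith)) 2
  have b1' := sq_nonneg (max (v - a * m) 0)
  have b2 : max (v - (n - a * m)) 0 ^ 2 ≤ v ^ 2 :=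
    pow_le_pow_left₀ (le_max_right _ _) (max_le (by linarith) hv) 2
  have b3 : v ^ 2 - 2 * a * v ≤ max (v - (n - a * m)) 0 ^ 2 := by
    rcases max_cases (v - (n - a * m)) 0 with ⟨h, h'⟩ | ⟨h, h'⟩ <;> rw [h] <;> nlinarith
  have b4 : (m : ℝ) * a ^ 2 ≤ a * n := by nlinarith
  have b5 : (a : ℝ) * v ≤ a * n := by nlinarith
  have b6 : (a : ℝ) * n ≤ a ^ 2 * n := by
    nlinarith [mul_nonneg (sub_nonneg.2 haR) (by linarith : (0 : ℝ) ≤ a * n)]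
  have b7 : (a : ℝ) ^ 2 ≤ a ^ 2 * n := by nlinarith [sq_nonneg (a : ℝ)]
  rw [abs_le] at *
  constructor <;> nlinarith [h1.1, h1.2, h2.1, h2.2]

/-! ### Decomposition of the configuration sum -/

/-- The sum of `f` over the middle part `(u, n - u]` of `(0, n]` (negated if `2 * u > n`). -/
noncomputable def middleSum (f : ℕ → ℝ) (n u : ℕ) : ℝ := partialSum f (n - u) - partialSum f u

/-- The sum over the configurations `(x, y, x + a * y)` in `[1, n]` that is four times the number
of monochromatic ones. -/
noncomputable def configSum (a n : ℕ) (f : ℕ → ℝ) : ℝ :=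
  ∑ y ∈ Finset.Ioc 0 (n / a), ∑ x ∈ Finset.Ioc 0 (n - a * y),
    (1 + f x * f y + f x * f (x + a * y) + f y * f (x + a * y))

lemma configSum_neg (a n : ℕ) (f : ℕ → ℝ) : configSum a n (fun k => -f k) = configSum a n f := by
  simp [configSum]

/-- Split the total sum by residues mod a and apply Cauchy–Schwarz to the a class sums. Expanding
their squares gives a diagonal contribution n and, twice, all pairs x < z with z = x + ay. -/
lemma sum_sq_le_residue (a n : ℕ) (ha : 1 ≤ a) {f : ℕ → ℝ} (hf : ∀ k, |f k| = 1) :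
    partialSum f n ^ 2 ≤ a * (n + 2 * ∑ y ∈ Finset.Ioc 0 (n / a),
      ∑ x ∈ Finset.Ioc 0 (n - a * y), f x * f (x + a * y)) := by
  have hsq : ∀ k, f k * f k = 1 := fun k => by
    rw [← abs_mul_abs_self, hf]; norm_num
  have h1 : partialSum f n = ∑ r ∈ Finset.range a, ∑ x ∈ Finset.Ioc 0 n with x % a = r, f x := by
    rw [partialSum, Finset.sum_fiberwise_of_maps_to]
    intro x _
    exact Finset.mem_range.2 (Nat.mod_lt _ ha)
  have h2 : partialSum f n ^ 2 ≤
      a * ∑ r ∈ Finset.range a, (∑ x ∈ Finset.Ioc 0 n with x % a = r, f x) ^ 2 := by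
    rw [h1]
    simpa using sq_sum_le_card_mul_sum_sq (s := Finset.range a)
      (f := fun r => ∑ x ∈ Finset.Ioc 0 n with x % a = r, f x)
  refine h2.trans (mul_le_mul_of_nonneg_left (le_of_eq ?_) (Nat.cast_nonneg a))
  have h3 : ∑ r ∈ Finset.range a, (∑ x ∈ Finset.Ioc 0 n with x % a = r, f x) ^ 2 =
      ∑ x ∈ Finset.Ioc 0 n, ∑ z ∈ Finset.Ioc 0 n, if z % a = x % a then f x * f z else 0 := by
    rw [← Finset.sum_fiberwise_of_maps_to (s := Finset.Ioc 0 n) (t := Finset.range a)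
      (g := fun x => x % a) (fun x _ => Finset.mem_range.2 (Nat.mod_lt _ ha))]
    refine Finset.sum_congr rfl fun r _ => ?_
    rw [sq, Finset.sum_mul]
    refine Finset.sum_congr rfl fun x hx => ?_
    rw [(Finset.mem_filter.1 hx).2, ← Finset.sum_filter, Finset.mul_sum]
  have h4 : ∀ x z : ℕ, (if z % a = x % a then f x * f z else 0) =
      (if z = x then 1 else 0) + (if x < z ∧ z % a = x % a then f x * f z else 0) +
      (if z < x ∧ x % a = z % a then f z * f x else 0) := by
    intro x z
    rcases lt_trichotomy x z with h | rfl | h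
    · simp [h, h.ne', h.not_gt]
    · simp [hsq]
    · simp [h, h.ne, h.not_gt, eq_comm, mul_comm]
  have h5 : ∑ x ∈ Finset.Ioc 0 n, ∑ z ∈ Finset.Ioc 0 n,
      (if x < z ∧ z % a = x % a then f x * f z else 0) =
      ∑ y ∈ Finset.Ioc 0 (n / a), ∑ x ∈ Finset.Ioc 0 (n - a * y), f x * f (x + a * y) := by
    rw [← Finset.sum_product', ← Finset.sum_filter, Finset.sum_sigma']
    refine Finset.sum_bij' (fun t _ => ⟨(t.2 - t.1) / a, t.1⟩)
      (fun t _ => (t.2, t.2 + a * t.1)) ?_ ?_ ?_ ?_ ?_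
    · rintro ⟨x, z⟩ h
      simp only [Finset.mem_filter, Finset.mem_product, Finset.mem_Ioc, Finset.mem_sigma] at h ⊢
      obtain ⟨⟨⟨hx, hx'⟩, hz, hz'⟩, hxz, hmod⟩ := h
      obtain ⟨k, hk⟩ := (Nat.modEq_iff_dvd' hxz.le).1 hmod.symm
      have hk0 : 0 < k := Nat.pos_of_ne_zero fun h => by subst h; omega
      rw [hk, Nat.mul_div_cancel_left k ha]
      refine ⟨⟨hk0, (Nat.le_div_iff_mul_le ha).2 ?_⟩, hx, ?_⟩
      · rw [mul_comm]; omega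
      · omega
    · rintro ⟨y, x⟩ h
      simp only [Finset.mem_filter, Finset.mem_product, Finset.mem_Ioc, Finset.mem_sigma] at h ⊢
      have := Nat.mul_pos ha h.1.1
      refine ⟨⟨⟨h.2.1, ?_⟩, ?_, ?_⟩, ?_, ?_⟩ <;> first | omega | simp
    · rintro ⟨x, z⟩ h
      simp only [Finset.mem_filter, Finset.mem_product, Finset.mem_Ioc] at h ⊢
      have := Nat.mul_div_cancel' ((Nat.modEq_iff_dvd' h.2.1.le).1 h.2.2.symm)
      ext
      · rfl
      · simp only; omega
    · rintro ⟨y, x⟩ h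
      simp [Nat.mul_div_cancel_left y ha]
    · rintro ⟨x, z⟩ h
      simp only [Finset.mem_filter, Finset.mem_product, Finset.mem_Ioc] at h ⊢
      have := Nat.mul_div_cancel' ((Nat.modEq_iff_dvd' h.2.1.le).1 h.2.2.symm)
      rw [this, Nat.add_sub_cancel' h.2.1.le]
  rw [h3]
  simp only [h4, Finset.sum_add_distrib]
  have h6 : ∑ x ∈ Finset.Ioc 0 n, ∑ z ∈ Finset.Ioc 0 n,
      (if z < x ∧ x % a = z % a then f z * f x else 0) =
      ∑ y ∈ Finset.Ioc 0 (n / a), ∑ x ∈ Finset.Ioc 0 (n - a * y), f x * f (x + a * y) := by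
    rw [Finset.sum_comm, h5]
  rw [h6, h5]
  have h7 : ∑ x ∈ Finset.Ioc 0 n, ∑ z ∈ Finset.Ioc 0 n, (if z = x then (1 : ℝ) else 0) = n := by
    rw [Finset.sum_congr rfl fun x hx => by rw [Finset.sum_ite_eq', if_pos hx]]
    simp
  rw [h7]; ring

/-- For fixed y, the two terms containing f(y) sum over x to f(y)S(n-ay) and f(y)(S(n) - S(ay)),
which together are f(y)(S(n) + V(ay)). -/
lemma configSum_eq (a n : ℕ) (f : ℕ → ℝ) :
    configSum a n f = ∑ y ∈ Finset.Ioc 0 (n / a), ((n : ℝ) - a * y) +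
      ∑ y ∈ Finset.Ioc 0 (n / a), ∑ x ∈ Finset.Ioc 0 (n - a * y), f x * f (x + a * y) +
      partialSum f n * partialSum f (n / a) +
      ∑ y ∈ Finset.Ioc 0 (n / a), f y * middleSum f n (a * y) := by
  rw [show partialSum f n * partialSum f (n / a) =
      ∑ y ∈ Finset.Ioc 0 (n / a), partialSum f n * f y from by
        rw [← Finset.mul_sum]; rfl]
  simp only [configSum, ← Finset.sum_add_distrib]
  refine Finset.sum_congr rfl fun y hy => ?_
  have hle : a * y ≤ n :=
    (Nat.mul_le_mul_left a (Finset.mem_Ioc.1 hy).2).trans (Nat.mul_div_le n a)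
  have h1 : ∑ x ∈ Finset.Ioc 0 (n - a * y), f x * f y = f y * partialSum f (n - a * y) := by
    rw [← Finset.sum_mul, mul_comm]; rfl
  have h2 : ∑ x ∈ Finset.Ioc 0 (n - a * y), f y * f (x + a * y) =
      f y * (partialSum f n - partialSum f (a * y)) := by
    rw [← Finset.mul_sum, partialSum_sub f hle]
    congr 1
    have := Finset.map_add_right_Ioc 0 (n - a * y) (a * y)
    rw [Nat.sub_add_cancel hle, Nat.zero_add] at this
    rw [← this, Finset.sum_map]
    rfl
  simp only [Finset.sum_add_distrib, h1, h2, middleSum]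
  simp [Nat.cast_sub hle]
  ring

/-! ### Reflection and correlation with the middle sums -/

/-- The point a(m+1-y) is within a of n - ay, where V takes exactly the opposite value; each
endpoint of the interval contributes an error of at most a. -/
lemma abs_middleSum_reflect {a n y : ℕ} {f : ℕ → ℝ} (hf : ∀ k, |f k| = 1)
    (ha : 1 ≤ a) (hy : y ∈ Finset.Ioc 0 (n / a)) :
    |middleSum f n (a * y) + middleSum f n (a * (n / a + 1 - y))| ≤ 2 * a := by
  have hm : a * (n / a) ≤ n := Nat.mul_div_le n a
  have hm' : n < a * (n / a) + a := by
    simpa [Nat.mul_add] using Nat.lt_mul_div_succ n (show 0 < a by omega)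
  obtain ⟨hy0, hy1⟩ := Finset.mem_Ioc.1 hy
  have e : a * (n / a + 1 - y) = a * (n / a) + a - a * y := by
    rw [Nat.mul_sub, Nat.mul_add, Nat.mul_one]
  have hay : a * y ≤ a * (n / a) := Nat.mul_le_mul_left a hy1
  have hay' : a ≤ a * y := Nat.le_mul_of_pos_right a hy0
  rw [e]
  generalize a * (n / a) = w at *
  generalize a * y = u at *
  have h1 := abs_partialSum_sub_le hf (show n - (w + a - u) ≤ u by omega)
  have h2 := abs_partialSum_sub_le hf (show n - u ≤ w + a - u by omega)
  have h3 : (u : ℝ) ≤ ((n - (w + a - u) : ℕ) : ℝ) + a := by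
    exact_mod_cast (show u ≤ n - (w + a - u) + a by omega)
  have h4 : ((w + a - u : ℕ) : ℝ) ≤ ((n - u : ℕ) : ℝ) + a := by
    exact_mod_cast (show w + a - u ≤ n - u + a by omega)
  unfold middleSum
  rw [abs_le] at *
  constructor <;> linarith [h1.1, h1.2, h2.1, h2.2]

lemma abs_sub_of_sign {x y : ℝ} (hx : |x| = 1) (hy : |y| = 1) : |x - y| = 2 - |x + y| := by
  rcases eq_or_eq_neg_of_abs_eq hx with rfl | rfl <;>
  rcases eq_or_eq_neg_of_abs_eq hy with rfl | rfl <;> norm_num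

lemma sum_Ioc_reflect (g : ℕ → ℝ) (m : ℕ) :
    ∑ y ∈ Finset.Ioc 0 m, g (m + 1 - y) = ∑ y ∈ Finset.Ioc 0 m, g y := by
  refine Finset.sum_bij' (fun y _ => m + 1 - y) (fun y _ => m + 1 - y) ?_ ?_ ?_ ?_ ?_ <;>
    intro y hy <;> simp only [Finset.mem_Ioc] at * <;> omega

/-- Pairing `y` with its mirror image turns the correlation of `f` with an odd function into an
integral of the absolute value. -/
lemma sum_mul_middleSum_ge {a n : ℕ} {f : ℕ → ℝ} (hf : ∀ k, |f k| = 1) (ha : 1 ≤ a)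
    {c : ℝ} {K : ℕ → ℝ} (hK : ∀ y ∈ Finset.Ioc 0 (n / a), 0 ≤ K y)
    (hle : ∀ y ∈ Finset.Ioc 0 (n / a), |middleSum f n (a * y)| ≤ c + K y) (hc : 0 ≤ c) :
    -(c * ((n / a : ℕ) - |partialSum f (n / a)|) + ∑ y ∈ Finset.Ioc 0 (n / a), K y + n) ≤
      ∑ y ∈ Finset.Ioc 0 (n / a), f y * middleSum f n (a * y) := by
  have hm : (a : ℝ) * (n / a : ℕ) ≤ n := by exact_mod_cast Nat.mul_div_le n a
  have hrefl := fun y hy => abs_middleSum_reflect (n := n) (y := y) hf ha hy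
  have hr := sum_Ioc_reflect (fun y => f y * middleSum f n (a * y)) (n / a)
  have hr' := sum_Ioc_reflect f (n / a)
  unfold partialSum
  generalize n / a = m at *
  have hpt : ∀ y ∈ Finset.Ioc 0 m,
      -(c * (2 - |f y + f (m + 1 - y)|) + 2 * K y + 2 * a) ≤
      f y * middleSum f n (a * y) + f (m + 1 - y) * middleSum f n (a * (m + 1 - y)) := by
    intro y hy
    set V := middleSum f n (a * y)
    set V' := middleSum f n (a * (m + 1 - y))
    have h1 : f y * V + f (m + 1 - y) * V' =
        (f y - f (m + 1 - y)) * V + f (m + 1 - y) * (V + V') := by ring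
    have h2 := abs_sub_of_sign (hf y) (hf (m + 1 - y))
    have h3 : |(f y - f (m + 1 - y)) * V| ≤ (2 - |f y + f (m + 1 - y)|) * (c + K y) := by
      rw [abs_mul, h2]
      exact mul_le_mul_of_nonneg_left (hle y hy) (h2 ▸ abs_nonneg _)
    have h4 : |f (m + 1 - y) * (V + V')| ≤ 2 * a := by
      rw [abs_mul, hf, one_mul]; exact hrefl y hy
    -- On K the weight 2 - |f(y) + f(m+1-y)| is relaxed to 2; on c it is kept, since there it
    -- produces the gain |S(m)|.
    have h5 := mul_nonneg (abs_nonneg (f y + f (m + 1 - y))) (hK y hy)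
    rw [h1]
    linarith [neg_abs_le ((f y - f (m + 1 - y)) * V), neg_abs_le (f (m + 1 - y) * (V + V'))]
  have hsum := Finset.sum_le_sum hpt
  have habs : 2 * |∑ y ∈ Finset.Ioc 0 m, f y| ≤ ∑ y ∈ Finset.Ioc 0 m, |f y + f (m + 1 - y)| := by
    refine le_trans (le_of_eq ?_) (Finset.abs_sum_le_sum_abs _ _)
    rw [Finset.sum_add_distrib, hr', ← two_mul, abs_mul, abs_two]
  rw [Finset.sum_neg_distrib, Finset.sum_add_distrib (f := fun y => f y * middleSum f n (a * y)),
    hr] at hsum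
  simp only [Finset.sum_add_distrib, ← Finset.mul_sum, Finset.sum_sub_distrib, Finset.sum_const,
    Nat.card_Ioc, nsmul_eq_mul, Nat.sub_zero] at hsum
  have := mul_le_mul_of_nonneg_left habs hc
  nlinarith

/-! ### Lower bound in terms of ramps -/

/-- `max (p - u) 0 + max (q - u) 0 ≤ max (v - u) 0` for `p + q ≤ v` and nonnegative numbers. -/
lemma posPart_add_le {p q v u : ℝ} (hp : 0 ≤ p) (hq : 0 ≤ q) (hv : p + q ≤ v) (hu : 0 ≤ u) :
    max (p - u) 0 + max (q - u) 0 ≤ max (v - u) 0 := by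
  rcases max_cases (p - u) 0 with ⟨h, h'⟩ | ⟨h, h'⟩ <;>
  rcases max_cases (q - u) 0 with ⟨k, k'⟩ | ⟨k, k'⟩ <;> rw [h, k] <;>
  first
  | exact le_max_of_le_left (by linarith)
  | exact le_max_of_le_right (by linarith)

lemma middleSum_reflect {f : ℕ → ℝ} {n u : ℕ} (hu : u ≤ n) :
    middleSum f n (n - u) = -middleSum f n u := by
  unfold middleSum
  rw [Nat.sub_sub_self hu]; ring

/-- On the left half, n - 2u ≤ (n - 2v) + 2 max(v-u, 0); the right half follows by reflection. Both
end corrections are nonnegative by `posPart_add_le`, so their sum serves for all u. -/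
lemma abs_middleSum_le_ramps {f : ℕ → ℝ} {n : ℕ} {p q v : ℝ} (hp : 0 ≤ p) (hq : 0 ≤ q)
    (hv : p + q ≤ v)
    (hdom : ∀ u : ℕ, 2 * u ≤ n →
      |middleSum f n u| ≤ n - 2 * u - 2 * max (p - u) 0 - 2 * max (q - u) 0)
    {u : ℕ} (hu : u ≤ n) :
    |middleSum f n u| ≤ (n - 2 * v) +
      (2 * (max (v - u) 0 - max (p - u) 0 - max (q - u) 0) +
        2 * (max (v - (n - u)) 0 - max (p - (n - u)) 0 - max (q - (n - u)) 0)) := by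
  have key : ∀ w : ℕ, 2 * w ≤ n → |middleSum f n w| ≤ (n - 2 * v) +
      2 * (max (v - w) 0 - max (p - w) 0 - max (q - w) 0) := by
    intro w hw
    have := hdom w hw
    have h2 := le_max_left (v - w) 0
    linarith
  have huR : (u : ℝ) ≤ n := by exact_mod_cast hu
  have hu0 : (0 : ℝ) ≤ u := Nat.cast_nonneg u
  have k1 := posPart_add_le hp hq hv hu0
  have k2 := posPart_add_le hp hq hv (sub_nonneg.2 huR)
  rcases le_total (2 * u) n with h | h
  · have := key u h
    linarith
  · have := key (n - u) (by omega)
    rw [middleSum_reflect hu, abs_neg, Nat.cast_sub hu] at this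
    linarith

/-- The main lower bound, given a bound for the middle sums. -/
lemma configSum_ge {a n : ℕ} {f : ℕ → ℝ} (hf : ∀ k, |f k| = 1) (ha : 1 ≤ a) (hn : 1 ≤ n)
    {p q v : ℝ} (hp : 0 ≤ p) (hq : 0 ≤ q) (hv : p + q ≤ v) (hvn : 2 * v ≤ n)
    (hdom : ∀ u : ℕ, 2 * u ≤ n →
      |middleSum f n u| ≤ n - 2 * u - 2 * max (p - u) 0 - 2 * max (q - u) 0) :
    (n : ℝ) ^ 2 / 2 + partialSum f n ^ 2 / 2 + a * partialSum f n * partialSum f (n / a)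
      - a * (n - 2 * v) * ((n / a : ℕ) - |partialSum f (n / a)|)
      - 2 * (v ^ 2 - p ^ 2 - q ^ 2) - 30 * a ^ 2 * n ≤ a * configSum a n f := by
  have hm : a * (n / a) ≤ n := Nat.mul_div_le n a
  have hmul : ∀ y ∈ Finset.Ioc 0 (n / a), a * y ≤ n := fun y hy =>
    (Nat.mul_le_mul_left a (Finset.mem_Ioc.1 hy).2).trans hm
  have haR : (1 : ℝ) ≤ a := by exact_mod_cast ha
  have hnR : (1 : ℝ) ≤ n := by exact_mod_cast hn
  set K : ℕ → ℝ := fun y =>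
    2 * (max (v - a * y) 0 - max (p - a * y) 0 - max (q - a * y) 0) +
        2 * (max (v - (n - a * y)) 0 - max (p - (n - a * y)) 0 - max (q - (n - a * y)) 0)
    with hKdef
  have hmulR : ∀ y ∈ Finset.Ioc 0 (n / a), (a : ℝ) * y ≤ n := fun y hy => by
    exact_mod_cast hmul y hy
  have hle : ∀ y ∈ Finset.Ioc 0 (n / a), |middleSum f n (a * y)| ≤ (n - 2 * v) + K y := by
    intro y hy
    have := abs_middleSum_le_ramps hp hq hv hdom (hmul y hy)
    push_cast at this
    exact this
  have hK : ∀ y ∈ Finset.Ioc 0 (n / a), 0 ≤ K y := by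
    intro y hy
    have k1 := posPart_add_le hp hq hv (by positivity : (0 : ℝ) ≤ a * y)
    have k2 := posPart_add_le hp hq hv (sub_nonneg.2 (hmulR y hy))
    simp only [hKdef]
    linarith
  have hcorr := sum_mul_middleSum_ge hf ha hK hle (by linarith)
  have hKsum : ∑ y ∈ Finset.Ioc 0 (n / a), K y =
      2 * (rampSum a n v - rampSum a n p - rampSum a n q) := by
    simp only [rampSum, ← Finset.sum_sub_distrib, Finset.mul_sum, hKdef]
    exact Finset.sum_congr rfl fun y _ => by ring
  have hRv := (abs_le.1 (abs_rampSum_sub_le ha hn (by linarith : 0 ≤ v) (by linarith))).2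
  have hRp := (abs_le.1 (abs_rampSum_sub_le ha hn hp (by linarith))).1
  have hRq := (abs_le.1 (abs_rampSum_sub_le ha hn hq (by linarith))).1
  have hres := sum_sq_le_residue a n ha hf
  have hT := (abs_le.1 (abs_sum_posPart_sub_le n (-a) (n / a))).2
  have hT' : ∑ y ∈ Finset.Ioc 0 (n / a), max ((n : ℝ) + -a * y) 0 =
      ∑ y ∈ Finset.Ioc 0 (n / a), ((n : ℝ) - a * y) :=
    Finset.sum_congr rfl fun y hy => by
      rw [max_eq_left (by linarith [hmulR y hy])]; ring
  rw [hT'] at hT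
  have hmR : (a : ℝ) * (n / a : ℕ) ≤ n := by exact_mod_cast hm
  have hmR' : (n : ℝ) ≤ a * (n / a : ℕ) + a := by
    have := Nat.lt_mul_div_succ n (show 0 < a by omega)
    rw [Nat.mul_add, Nat.mul_one] at this
    exact_mod_cast this.le
  rw [max_eq_left (by linarith), max_eq_left (by linarith)] at hT
  have hc := mul_le_mul_of_nonneg_left hcorr (by linarith : (0 : ℝ) ≤ a)
  rw [hKsum] at hc
  rw [configSum_eq]
  generalize ∑ y ∈ Finset.Ioc 0 (n / a), ((n : ℝ) - a * y) = T at *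
  generalize ∑ y ∈ Finset.Ioc 0 (n / a), ∑ x ∈ Finset.Ioc 0 (n - a * y), f x * f (x + a * y) = X
    at *
  generalize ∑ y ∈ Finset.Ioc 0 (n / a), f y * middleSum f n (a * y) = Z at *
  generalize ((n / a : ℕ) : ℝ) = m at *
  have b1 : ((n : ℝ) + -a * m) ^ 2 ≤ (a : ℝ) ^ 2 :=
    pow_le_pow_left₀ (by linarith) (by linarith) 2
  have b4 : (m : ℝ) * (-a : ℝ) ^ 2 ≤ a * n := by nlinarith
  have b6 : (a : ℝ) * n ≤ a ^ 2 * n := by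
    nlinarith [mul_nonneg (sub_nonneg.2 haR) (by positivity : (0 : ℝ) ≤ a * n)]
  have b7 : (a : ℝ) ^ 2 ≤ a ^ 2 * n := by nlinarith [sq_nonneg (a : ℝ)]
  have b8 : (0 : ℝ) ≤ a ^ 2 * n := by positivity
  linarith

/-! ### Optimization according to the signs of the sums -/

lemma sub_max_sub_max_ge {x p q u : ℝ} {N : ℝ} (h0 : x ≤ N - 2 * u)
    (hp : x ≤ N - 2 * u - 2 * (p - u)) (hq : x ≤ N - 2 * u - 2 * (q - u))
    (hpq : x ≤ N - 2 * u - 2 * (p - u) - 2 * (q - u)) :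
    x ≤ N - 2 * u - 2 * max (p - u) 0 - 2 * max (q - u) 0 := by
  rcases max_cases (p - u) 0 with ⟨h, -⟩ | ⟨h, -⟩ <;>
  rcases max_cases (q - u) 0 with ⟨k, -⟩ | ⟨k, -⟩ <;> rw [h, k] <;> linarith

lemma abs_middleSum_le {f : ℕ → ℝ} (hf : ∀ k, |f k| = 1) {n u : ℕ} (hu : 2 * u ≤ n) :
    |middleSum f n u| ≤ n - 2 * u := by
  have := abs_partialSum_sub_le hf (show u ≤ n - u by omega)
  rw [Nat.cast_sub (by omega)] at this
  unfold middleSum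
  linarith

/-- Minimization of the main lower bound in the case of opposite signs. -/
lemma optimize_of_nonpos {a n m F G M : ℝ} (haR : 2 ≤ a) (hnR : 1 ≤ n) (hm0 : 0 ≤ m)
    (hmR : a * m ≤ n) (hmR' : n ≤ a * m + a) (hF : F ≤ 0) (hG : 0 ≤ G)
    (hFG : -(n - m) ≤ F - G)
    (core : ∀ q v : ℝ, 0 ≤ q → q ≤ m → q ≤ (n - m + F - G) / 2 → (m + G) / 2 + q ≤ v → 2 * v ≤ n →
      n ^ 2 / 2 + F ^ 2 / 2 + a * F * G - a * (n - 2 * v) * (m - G)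
        - 2 * (v ^ 2 - ((m + G) / 2) ^ 2 - q ^ 2) - 30 * a ^ 2 * n ≤ M) :
    2 * n ^ 2 / (a ^ 2 + 2 * a + 3) - 40 * a ^ 2 * n ≤ M := by
  obtain ⟨p, hp⟩ : ∃ p, p = (m + G) / 2 := ⟨_, rfl⟩
  obtain ⟨q, hq⟩ : ∃ q, q = (n - m + F - G) / 2 := ⟨_, rfl⟩
  obtain ⟨l, hl⟩ : ∃ l, l = a * (m - p) := ⟨_, rfl⟩
  obtain ⟨e, he⟩ : ∃ e, e = n - a * m := ⟨_, rfl⟩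
  rw [← hp, ← hq] at core
  have hD : 0 < a ^ 2 + 2 * a + 3 := by positivity
  have hp0 : 0 ≤ p := by linarith
  have hq0 : 0 ≤ q := by linarith
  have hl2 : 2 * l ≤ n := by
    have : a * (2 * (m - p)) ≤ a * m := mul_le_mul_of_nonneg_left (by linarith) (by linarith)
    linarith
  -- A concave parabola in v with vertex l: the best v ≥ p + q is max(l, p + q), and both candidates
  -- are at most n/2.
  have hval : ∀ q1 v : ℝ, n ^ 2 / 2 + F ^ 2 / 2 + a * F * G - a * (n - 2 * v) * (m - G)
      - 2 * (v ^ 2 - p ^ 2 - q1 ^ 2) =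
      2 * (p + q - l) ^ 2 - 2 * (v - l) ^ 2 + 2 * p ^ 2 + 2 * q1 ^ 2 - e * F := by
    intro q1 v
    have h1 : F = 2 * (p + q) - n := by linarith
    have h2 : G = 2 * p - m := by linarith
    have h3 : n = e + a * m := by linarith
    rw [h1, h2, hl, h3]; ring
  have heF : 0 ≤ -(e * F) := by
    have : 0 ≤ e * -F := mul_nonneg (by linarith) (by linarith)
    linarith
  have he2 : n ^ 2 - 2 * a * n ≤ (n - e) ^ 2 := by nlinarith
  have han : a * n ≤ a ^ 2 * n := by
    nlinarith [mul_nonneg (by linarith : 0 ≤ a - 1) (by positivity : 0 ≤ a * n)]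
  -- As e ≤ a, passing from n to n - e = am costs O(an), absorbed by raising 30 to 40.
  have hfin : ∀ X : ℝ, (n - e) ^ 2 ≤ (a ^ 2 + 2 * a + 3) * X → X * 2 - 30 * a ^ 2 * n ≤ M →
      2 * n ^ 2 / (a ^ 2 + 2 * a + 3) - 40 * a ^ 2 * n ≤ M := by
    intro X hX hXM
    have : 2 * n ^ 2 / (a ^ 2 + 2 * a + 3) ≤ 2 * X + 4 * a * n := by
      rw [div_le_iff₀ hD]
      nlinarith [mul_nonneg (by positivity : 0 ≤ 4 * a * n) (by positivity : 0 ≤ a ^ 2 + 2 * a + 2)]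
    nlinarith
  rcases le_total q m with hqm | hqm
  · rcases le_total (p + q) l with h | h
    · have := core q l hq0 hqm le_rfl h hl2
      rw [hval] at this
      refine hfin ((p + q - l) ^ 2 + p ^ 2 + q ^ 2) ?_ (by linarith)
      -- Cauchy–Schwarz against (1, a+1, 1); the three squares used below are the minors in
      -- Lagrange's identity.
      have : n - e = (l - (p + q)) + (a + 1) * p + q := by rw [hl, he]; ring
      rw [this]
      linarith [sq_nonneg ((a + 1) * (l - (p + q)) - p), sq_nonneg ((l - (p + q)) - q),
        sq_nonneg ((a + 1) * q - p)]
    · have := core q (p + q) hq0 hqm le_rfl le_rfl (by linarith)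
      rw [hval] at this
      refine hfin (p ^ 2 + q ^ 2) ?_ (by linarith)
      have h1 : n - e ≤ (a + 1) * p + q := by
        have : n - e = l + a * p := by rw [hl, he]; ring
        linarith
      have h2 : 0 ≤ n - e := by rw [he]; ring_nf; positivity
      have h3 : (n - e) ^ 2 ≤ ((a + 1) * p + q) ^ 2 := pow_le_pow_left₀ h2 h1 2
      linarith [sq_nonneg ((a + 1) * q - p), sq_nonneg p, sq_nonneg q]
  -- The ramp length may not exceed m, so it is capped there; n - e = am then suffices with room to
  -- spare.
  · have hX : (n - e) ^ 2 ≤ (a ^ 2 + 2 * a + 3) * (p ^ 2 + m ^ 2) := by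
      have : n - e = a * m := by rw [he]; ring
      rw [this]
      have : 0 ≤ (2 * a + 3) * m ^ 2 + (a ^ 2 + 2 * a + 3) * p ^ 2 := by positivity
      linarith
    rcases le_total (p + m) l with h | h
    · have := core m l hm0 le_rfl hqm h hl2
      rw [hval] at this
      exact hfin _ hX (by linarith [sq_nonneg (p + q - l)])
    · have := core m (p + m) hm0 le_rfl hqm le_rfl (by linarith)
      rw [hval] at this
      have h2 : (p + m - l) ^ 2 ≤ (p + q - l) ^ 2 :=
        pow_le_pow_left₀ (by linarith) (by linarith) 2
      exact hfin _ hX (by linarith)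

/-- Opposite signs of the total sum and the initial sum. -/
lemma configSum_ge_of_nonpos {a n : ℕ} {f : ℕ → ℝ} (hf : ∀ k, |f k| = 1) (ha : 2 ≤ a)
    (hn : 1 ≤ n) (hF : partialSum f n ≤ 0) (hG : 0 ≤ partialSum f (n / a)) :
    2 * (n : ℝ) ^ 2 / (a ^ 2 + 2 * a + 3) - 40 * a ^ 2 * n ≤ a * configSum a n f := by
  have hm2 : 2 * (n / a) ≤ n := (Nat.mul_le_mul_right _ ha).trans (Nat.mul_div_le n a)
  have hmR : (a : ℝ) * (n / a : ℕ) ≤ n := by exact_mod_cast Nat.mul_div_le n a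
  have hmR' : (n : ℝ) ≤ a * (n / a : ℕ) + a := by
    have := Nat.lt_mul_div_succ n (show 0 < a by omega)
    rw [Nat.mul_add, Nat.mul_one] at this
    exact_mod_cast this.le
  have haR : (2 : ℝ) ≤ a := by exact_mod_cast ha
  have hnR : (1 : ℝ) ≤ n := by exact_mod_cast hn
  have hm0 : (0 : ℝ) ≤ (n / a : ℕ) := Nat.cast_nonneg _
  have hm2R : 2 * ((n / a : ℕ) : ℝ) ≤ n := by exact_mod_cast hm2
  have core := fun (p q v : ℝ) hp hq hv hvn => configSum_ge (p := p) (q := q) (v := v) hf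
    (show 1 ≤ a by omega) hn hp hq hv hvn
  have lipm := abs_partialSum_sub_le hf (Nat.zero_le (n / a))
  have lipn := abs_partialSum_sub_le hf (show n / a ≤ n by omega)
  rw [partialSum_zero, abs_le, Nat.cast_zero] at lipm
  rw [abs_le] at lipn
  -- |V(u)| ≤ n - 2u - 2k once (u, n-u] contains k elements of each sign. For u ≤ m, at least p-u
  -- values +1 remain in (u, m] and q-u in (m, n-u]; the signs of F and G and 2m ≤ n provide as many
  -- values -1. For u ≥ m both ramps vanish.
  have hdom : ∀ q1 : ℝ, q1 ≤ (n / a : ℕ) →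
      q1 ≤ (n - (n / a : ℕ) + partialSum f n - partialSum f (n / a)) / 2 → ∀ u : ℕ, 2 * u ≤ n →
      |middleSum f n u| ≤ n - 2 * u - 2 * max (((n / a : ℕ) + partialSum f (n / a)) / 2 - u) 0
        - 2 * max (q1 - u) 0 := by
    intro q1 hq1 hq1' u hu
    have huR : 2 * (u : ℝ) ≤ n := by exact_mod_cast hu
    have triv := abs_middleSum_le hf hu
    rcases le_total u (n / a) with hum | hum
    · have l1 := abs_partialSum_sub_le hf (Nat.zero_le u)
      have l2 := abs_partialSum_sub_le hf hum
      have l3 := abs_partialSum_sub_le hf (show n / a ≤ n - u by omega)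
      have l4 := abs_partialSum_sub_le hf (show n - u ≤ n by omega)
      rw [partialSum_zero, Nat.cast_zero] at l1
      rw [Nat.cast_sub (by omega)] at l3 l4
      rw [abs_le] at l1 l2 l3 l4
      have l5 := abs_le.1 triv
      unfold middleSum at *
      apply sub_max_sub_max_ge triv <;> rw [abs_le] <;> constructor <;> linarith
    · have humR : ((n / a : ℕ) : ℝ) ≤ u := by exact_mod_cast hum
      rw [max_eq_right (by linarith), max_eq_right (by linarith)]
      linarith
  rw [abs_of_nonneg hG] at core
  refine optimize_of_nonpos haR hnR hm0 hmR hmR' hF hG lipn.1 ?_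
  intro q v hq hqm hq' hv hvn
  exact core _ q v (by linarith) hq hv hvn (hdom q hqm hq')

/-- Equal signs of the total sum and the initial sum. -/
lemma configSum_ge_of_nonneg {a n : ℕ} {f : ℕ → ℝ} (hf : ∀ k, |f k| = 1) (ha : 2 ≤ a)
    (hn : 1 ≤ n) (hF : 0 ≤ partialSum f n) (hG : 0 ≤ partialSum f (n / a)) :
    2 * (n : ℝ) ^ 2 / (a ^ 2 + 2 * a + 3) - 40 * a ^ 2 * n ≤ a * configSum a n f := by
  have hmR : (a : ℝ) * (n / a : ℕ) ≤ n := by exact_mod_cast Nat.mul_div_le n a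
  have hmR' : (n : ℝ) ≤ a * (n / a : ℕ) + a := by
    have := Nat.lt_mul_div_succ n (show 0 < a by omega)
    rw [Nat.mul_add, Nat.mul_one] at this
    exact_mod_cast this.le
  have haR : (2 : ℝ) ≤ a := by exact_mod_cast ha
  have hnR : (1 : ℝ) ≤ n := by exact_mod_cast hn
  -- With v = n/2 the term carrying the factor n - 2v disappears.
  have core := fun (p q : ℝ) hp hq hv => configSum_ge (p := p) (q := q) (v := n / 2) hf
    (show 1 ≤ a by omega) hn hp hq hv (by linarith)
  have lipm := abs_partialSum_sub_le hf (Nat.zero_le (n / a))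
  have lipn := abs_partialSum_sub_le hf (show n / a ≤ n from Nat.div_le_self n a)
  have lipn0 := abs_partialSum_sub_le hf (Nat.zero_le n)
  rw [partialSum_zero, abs_le, Nat.cast_zero] at lipm lipn0
  rw [abs_le] at lipn
  have hD : (0 : ℝ) < a ^ 2 + 2 * a + 3 := by positivity
  -- There are (n-F)/2 values -1, of which at most 2u lie outside (u, n-u]; the values +1 are at
  -- least as many.
  have crude := core ((n - partialSum f n) / 4) ((n - partialSum f n) / 4)
    (by linarith) (by linarith) (by linarith) (by
      intro u hu
      have triv := abs_middleSum_le hf hu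
      have l1 := abs_partialSum_sub_le hf (Nat.zero_le u)
      have l4 := abs_partialSum_sub_le hf (show n - u ≤ n by omega)
      rw [partialSum_zero, Nat.cast_zero] at l1
      rw [Nat.cast_sub (by omega)] at l4
      rw [abs_le] at l1 l4
      have l5 := abs_le.1 triv
      have : 2 * max ((n - partialSum f n) / 4 - u) 0 ≤ max ((n - partialSum f n) / 2 - 2 * u) 0 := by
        rw [mul_max_of_nonneg _ _ (by norm_num)]
        apply le_of_eq; congr 1 <;> ring
      suffices |middleSum f n u| ≤ n - 2 * u - 2 * max ((n - partialSum f n) / 2 - 2 * u) 0 by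
        linarith
      rcases max_cases ((n - partialSum f n) / 2 - 2 * (u : ℝ)) 0 with ⟨h, -⟩ | ⟨h, -⟩ <;> rw [h]
      · unfold middleSum at *
        rw [abs_le]; constructor <;> linarith
      · linarith)
  have hFG : 0 ≤ a * partialSum f n * partialSum f (n / a) := by positivity
  have han : (0 : ℝ) ≤ a ^ 2 * n := by positivity
  have hfin : ∀ b : ℝ, 0 ≤ b → b ≤ a ^ 2 + 2 * a + 3 → ∀ Y : ℝ,
      2 * (n : ℝ) ^ 2 ≤ b * Y → Y - 40 * a ^ 2 * n ≤ a * configSum a n f →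
      2 * (n : ℝ) ^ 2 / (a ^ 2 + 2 * a + 3) - 40 * a ^ 2 * n ≤ a * configSum a n f := by
    intro b hb hbD Y hY hYM
    have : 2 * (n : ℝ) ^ 2 / (a ^ 2 + 2 * a + 3) ≤ Y := by
      rw [div_le_iff₀ hD]
      have : 0 < b * Y := lt_of_lt_of_le (by positivity) hY
      have hY0 : 0 < Y := pos_of_mul_pos_right this hb
      nlinarith
    linarith
  replace crude := (sub_le_sub_left (by linarith : 30 * (a : ℝ) ^ 2 * n ≤ 40 * a ^ 2 * n) _).trans crude
  -- The crude main term (3F² - 2nF + n²)/4 + aFG is at least n²/6. This suffices for a ≥ 3, where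
  -- a² + 2a + 3 ≥ 18, but not for a = 2, where 2/11 is needed.
  rcases Nat.lt_or_ge 2 a with h3 | h3
  · have haR3 : (3 : ℝ) ≤ a := by exact_mod_cast h3
    refine hfin 18 (by norm_num) (by nlinarith) _ ?_ crude
    nlinarith [sq_nonneg (3 * partialSum f n - n)]
  · obtain rfl : a = 2 := le_antisymm h3 ha
    by_cases hFG' : partialSum f n ≤ partialSum f (n / 2)
    · refine hfin 11 (by norm_num) (by norm_num) _ ?_ crude
      push_cast
      nlinarith [mul_nonneg hF (sub_nonneg.2 hFG'), sq_nonneg (partialSum f n - n / 11)]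
    -- Count the values -1 separately in the two halves; F > G ensures that +1 is no rarer in the
    -- second half. The main term F² + FG + G² + n²/4 - nF/2 is at least 3n²/16, and 3/16 > 2/11.
    · have fine := core (((n / 2 : ℕ) - partialSum f (n / 2)) / 2)
        ((n - (n / 2 : ℕ) - (partialSum f n - partialSum f (n / 2))) / 2)
        (by linarith) (by linarith) (by linarith) (by
          intro u hu
          have triv := abs_middleSum_le hf hu
          have hum : u ≤ n / 2 := by omega
          have l1 := abs_partialSum_sub_le hf (Nat.zero_le u)
          have l2 := abs_partialSum_sub_le hf hum
          have l3 := abs_partialSum_sub_le hf (show n / 2 ≤ n - u by omega)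
          have l4 := abs_partialSum_sub_le hf (show n - u ≤ n by omega)
          rw [partialSum_zero, Nat.cast_zero] at l1
          rw [Nat.cast_sub (by omega)] at l3 l4
          rw [abs_le] at l1 l2 l3 l4
          have l5 := abs_le.1 triv
          unfold middleSum at *
          apply sub_max_sub_max_ge triv <;> rw [abs_le] <;> constructor <;> linarith)
      have hv : |(n : ℝ) - 2 * (n / 2 : ℕ)| ≤ 2 := by
        push_cast at hmR hmR'
        rw [abs_le]; constructor <;> linarith
      have hw : |partialSum f n - 2 * partialSum f (n / 2)| ≤ 3 * n := by
        push_cast at hmR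
        rw [abs_le]; constructor <;> linarith
      have hvw : ((n : ℝ) - 2 * (n / 2 : ℕ)) * (partialSum f n - 2 * partialSum f (n / 2)) ≤
          2 * (3 * n) := by
        refine (le_abs_self _).trans ?_
        rw [abs_mul]
        exact mul_le_mul hv hw (abs_nonneg _) (by norm_num)
      refine hfin 11 (by norm_num) (by norm_num) (3 / 16 * n ^ 2) (by nlinarith) ?_
      push_cast at fine hFG ⊢
      nlinarith [sq_nonneg (partialSum f n - n / 4), sq_nonneg (partialSum f (n / 2)),
        sq_nonneg ((n : ℝ) - 2 * (n / 2 : ℕ))]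

lemma configSum_lower_bound {a n : ℕ} {f : ℕ → ℝ} (hf : ∀ k, |f k| = 1) (ha : 2 ≤ a)
    (hn : 1 ≤ n) :
    2 * (n : ℝ) ^ 2 / (a ^ 2 + 2 * a + 3) - 40 * a ^ 2 * n ≤ a * configSum a n f := by
  have hf' : ∀ k, |(fun k => -f k) k| = 1 := fun k => by simp [hf]
  rcases le_total 0 (partialSum f (n / a)) with hG | hG
  · rcases le_total 0 (partialSum f n) with hF | hF
    · exact configSum_ge_of_nonneg hf ha hn hF hG
    · exact configSum_ge_of_nonpos hf ha hn hF hG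
  · rw [← configSum_neg]
    have hG' : 0 ≤ partialSum (fun k => -f k) (n / a) := by rw [partialSum_neg]; linarith
    rcases le_total 0 (partialSum f n) with hF | hF
    · exact configSum_ge_of_nonpos hf' ha hn (by rw [partialSum_neg]; linarith) hG'
    · exact configSum_ge_of_nonneg hf' ha hn (by rw [partialSum_neg]; linarith) hG'

/-! ### From colorings to sign functions and triangles -/

/-- The `±1`-valued function on `ℕ` that encodes a 2-coloring of `[1, n]`. -/
noncomputable def colorSign {n : ℕ} (c : TwoColoring n) (k : ℕ) : ℝ :=
  -- The default 1 keeps |f| = 1 on all of ℕ; the configuration sum only evaluates f inside [1, n].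
  if h : k ∈ Finset.Icc 1 n then (if c ⟨k, h⟩ then 1 else -1) else 1

lemma abs_colorSign {n : ℕ} (c : TwoColoring n) (k : ℕ) : |colorSign c k| = 1 := by
  unfold colorSign
  split_ifs <;> simp

lemma colorSign_eq_iff {n : ℕ} (c : TwoColoring n) (x y : ↥(Finset.Icc 1 n)) :
    colorSign c x = colorSign c y ↔ c x = c y := by
  have h : ∀ x : ↥(Finset.Icc 1 n), colorSign c x = if c x then 1 else -1 := fun x => by
    unfold colorSign; rw [dif_pos x.2]
  rw [h, h]
  cases c x <;> cases c y <;> norm_num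

/-- The pairs `(y, x)` of positive integers with `x + a * y ≤ t`. -/
def trianglePairs (a t : ℕ) : Finset (Σ _ : ℕ, ℕ) :=
  (Finset.Ioc 0 (t / a)).sigma fun y => Finset.Ioc 0 (t - a * y)

lemma mem_trianglePairs {a t : ℕ} (ha : 1 ≤ a) {w : Σ _ : ℕ, ℕ} :
    w ∈ trianglePairs a t ↔ 0 < w.1 ∧ 0 < w.2 ∧ w.2 + a * w.1 ≤ t := by
  simp only [trianglePairs, Finset.mem_sigma, Finset.mem_Ioc, Nat.le_div_iff_mul_le ha]
  rw [mul_comm w.1 a]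
  omega

lemma card_trianglePairs_le (a t : ℕ) :
    2 * a * ((trianglePairs a t).card : ℝ) ≤ t ^ 2 + a * t := by
  have hm : (a : ℝ) * (t / a : ℕ) ≤ t := by exact_mod_cast Nat.mul_div_le t a
  have hmul : ∀ y ∈ Finset.Ioc 0 (t / a), a * y ≤ t := fun y hy =>
    (Nat.mul_le_mul_left a (Finset.mem_Ioc.1 hy).2).trans (Nat.mul_div_le t a)
  have hcard : ((trianglePairs a t).card : ℝ) =
      ∑ y ∈ Finset.Ioc 0 (t / a), max ((t : ℝ) + -a * y) 0 := by
    rw [trianglePairs, Finset.card_sigma]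
    push_cast
    refine Finset.sum_congr rfl fun y hy => ?_
    have h : (a : ℝ) * y ≤ t := by exact_mod_cast hmul y hy
    rw [Nat.card_Ioc, Nat.sub_zero, Nat.cast_sub (hmul y hy), max_eq_left (by linarith)]
    push_cast; ring
  have h := (abs_le.1 (abs_sum_posPart_sub_le t (-a) (t / a))).1
  rw [← hcard, max_eq_left (Nat.cast_nonneg t)] at h
  have h2 := sq_nonneg (max ((t : ℝ) + -a * (t / a : ℕ)) 0)
  have h3 : ((t / a : ℕ) : ℝ) * (-a) ^ 2 ≤ a * t := by
    have := mul_le_mul_of_nonneg_left hm (Nat.cast_nonneg (α := ℝ) a)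
    linarith
  linarith

lemma mem_monoTriples {a n : ℕ} {c : TwoColoring n}
    {t : ↥(Finset.Icc 1 n) × ↥(Finset.Icc 1 n) × ↥(Finset.Icc 1 n)} :
    t ∈ monoTriples a n c ↔
      (t.1 : ℕ) + a * (t.2.1 : ℕ) = (t.2.2 : ℕ) ∧ c t.1 = c t.2.1 ∧ c t.2.1 = c t.2.2 := by
  simp [monoTriples]

lemma four_mul_card_monoTriples {a n : ℕ} (ha : 1 ≤ a) (c : TwoColoring n) :
    4 * ((monoTriples a n c).card : ℝ) = configSum a n (colorSign c) := by
  have hcard : (monoTriples a n c).card = ((trianglePairs a n).filter fun w =>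
      colorSign c w.2 = colorSign c w.1 ∧
        colorSign c w.1 = colorSign c (w.2 + a * w.1)).card := by
    refine Finset.card_bij (fun t _ => ⟨t.2.1, t.1⟩) ?_ ?_ ?_
    · rintro ⟨x, y, z⟩ h
      obtain ⟨h1, h2, h3⟩ := mem_monoTriples.1 h
      have hx := Finset.mem_Icc.1 x.2
      have hy := Finset.mem_Icc.1 y.2
      have hz := Finset.mem_Icc.1 z.2
      simp only at h1 h2 h3
      simp only [Finset.mem_filter, mem_trianglePairs ha]
      rw [h1, colorSign_eq_iff, colorSign_eq_iff]
      exact ⟨⟨hy.1, hx.1, hz.2⟩, h2, h3⟩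
    · rintro ⟨x, y, z⟩ h ⟨x', y', z'⟩ h' e
      have h1 := (mem_monoTriples.1 h).1
      have h1' := (mem_monoTriples.1 h').1
      simp only [Sigma.mk.injEq, heq_eq_eq] at e h1 h1'
      obtain ⟨e1, e2⟩ := e
      have e3 : (z : ℕ) = z' := by rw [← h1, ← h1', e1, e2]
      simp only [Prod.mk.injEq]
      exact ⟨Subtype.ext e2, Subtype.ext e1, Subtype.ext e3⟩
    · rintro ⟨y, x⟩ h
      simp only [Finset.mem_filter, mem_trianglePairs ha] at h
      obtain ⟨⟨hy, hx, hz⟩, h2, h3⟩ := h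
      have hay : y ≤ a * y := Nat.le_mul_of_pos_left y ha
      refine ⟨⟨⟨x, Finset.mem_Icc.2 ⟨hx, by omega⟩⟩, ⟨y, Finset.mem_Icc.2 ⟨hy, by omega⟩⟩,
        ⟨x + a * y, Finset.mem_Icc.2 ⟨by omega, hz⟩⟩⟩, ?_, rfl⟩
      rw [mem_monoTriples, ← colorSign_eq_iff, ← colorSign_eq_iff]
      exact ⟨rfl, h2, h3⟩
  have hterm : ∀ x y z : ℕ, 1 + colorSign c x * colorSign c y + colorSign c x * colorSign c z +
      colorSign c y * colorSign c z =
      if colorSign c x = colorSign c y ∧ colorSign c y = colorSign c z then 4 else 0 := by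
    intro x y z
    rcases eq_or_eq_neg_of_abs_eq (abs_colorSign c x) with h | h <;>
    rcases eq_or_eq_neg_of_abs_eq (abs_colorSign c y) with h' | h' <;>
    rcases eq_or_eq_neg_of_abs_eq (abs_colorSign c z) with h'' | h'' <;>
    rw [h, h', h''] <;> norm_num
  rw [hcard, configSum, Finset.sum_sigma']
  simp only [hterm]
  rw [← Finset.sum_filter, Finset.sum_const, nsmul_eq_mul, mul_comm]
  rfl

/-- Translating (x, y) by (-i, -j) lowers x + ay by i + aj, and z is determined by x and y. -/
lemma card_le_card_trianglePairs {a n : ℕ} (ha : 1 ≤ a) (i j s : ℕ)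
    (E : Finset (↥(Finset.Icc 1 n) × ↥(Finset.Icc 1 n) × ↥(Finset.Icc 1 n)))
    (hE : ∀ t ∈ E, (t.1 : ℕ) + a * (t.2.1 : ℕ) = (t.2.2 : ℕ) ∧ i < (t.1 : ℕ) ∧ j < (t.2.1 : ℕ) ∧
      (t.2.2 : ℕ) ≤ s + i + a * j) :
    E.card ≤ (trianglePairs a s).card := by
  refine Finset.card_le_card_of_injOn (fun t => ⟨t.2.1 - j, t.1 - i⟩) ?_ ?_
  · rintro ⟨x, y, z⟩ h
    obtain ⟨h1, h2, h3, h4⟩ := hE _ h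
    simp only [Finset.mem_coe, mem_trianglePairs ha] at *
    have := Nat.mul_le_mul_left a h3.le
    rw [Nat.mul_sub]
    omega
  · rintro ⟨x, y, z⟩ h ⟨x', y', z'⟩ h' e
    obtain ⟨h1, h2, h3, -⟩ := hE _ h
    obtain ⟨h1', h2', h3', -⟩ := hE _ h'
    simp only [Sigma.mk.injEq, heq_eq_eq] at *
    have e2 : (x : ℕ) = x' := by omega
    have e1 : (y : ℕ) = y' := by omega
    have e3 : (z : ℕ) = z' := by rw [← h1, ← h1', e1, e2]
    simp only [Prod.mk.injEq]
    exact ⟨Subtype.ext e2, Subtype.ext e1, Subtype.ext e3⟩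

/-! ### The three-block coloring -/

lemma redBlueRed_eq_true_iff {a n : ℕ} (k : ↥(Finset.Icc 1 n)) :
    redBlueRed a n k = true ↔ (k : ℕ) ≤ (a + 1) * n / (a ^ 2 + 2 * a + 3) ∨
      (a ^ 2 + 2 * a + 2) * n / (a ^ 2 + 2 * a + 3) < (k : ℕ) := by
  have hD : 0 < a ^ 2 + 2 * a + 3 := by positivity
  rw [redBlueRed, decide_eq_true_iff, Nat.le_div_iff_mul_le hD, Nat.div_lt_iff_lt_mul hD,
    mul_comm (k : ℕ)]

/-- If y is in the first block, then x + ay ≤ (a+1)²n/(a²+2a+3), short of the last block. If y is in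
the last block, then ay ≥ 2y already exceeds n, that block lying beyond n/2. -/
lemma redBlueRed_no_mixed {a n x y : ℕ} (ha : 2 ≤ a) (hx0 : 0 < x)
    (hx : x ≤ (a + 1) * n / (a ^ 2 + 2 * a + 3))
    (hy : y ≤ (a + 1) * n / (a ^ 2 + 2 * a + 3) ∨
      (a ^ 2 + 2 * a + 2) * n / (a ^ 2 + 2 * a + 3) < y)
    (hz : (a ^ 2 + 2 * a + 2) * n / (a ^ 2 + 2 * a + 3) < x + a * y) (hzn : x + a * y ≤ n) :
    False := by
  have hD : 0 < a ^ 2 + 2 * a + 3 := by positivity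
  rw [Nat.le_div_iff_mul_le hD] at hx hy
  rw [Nat.div_lt_iff_lt_mul hD] at hy hz
  rcases hy with hy | hy
  · have h := Nat.mul_le_mul_left a hy
    nlinarith
  · have h1 : 2 * y ≤ a * y := Nat.mul_le_mul_right y ha
    have h2 : 2 * y + 1 ≤ n := by omega
    have h3 : (a ^ 2 + 2 * a + 3) * (2 * y + 1) ≤ (a ^ 2 + 2 * a + 3) * n :=
      Nat.mul_le_mul_left _ h2
    nlinarith

/-- The leading squares add up to ((a+1)² + 1 + 1)w² = n²/(a²+2a+3); the slack a+1 allows for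
rounding of the block ends. -/
lemma three_triangles_le {a n w r s t : ℝ} (ha : 2 ≤ a) (hn : 1 ≤ n) (hw : 0 ≤ w)
    (hwn : w * (a ^ 2 + 2 * a + 3) = n) (hr0 : 0 ≤ r) (hr : r ≤ (a + 1) * w)
    (hs0 : 0 ≤ s) (hs : s ≤ w + (a + 1)) (ht0 : 0 ≤ t) (ht : t ≤ w + (a + 1)) :
    (r ^ 2 + a * r) + (s ^ 2 + a * s) + (t ^ 2 + a * t) ≤
      n ^ 2 / (a ^ 2 + 2 * a + 3) + 20 * a ^ 2 * n := by
  have ha0 : 0 ≤ a := by linarith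
  have hsq : n ^ 2 / (a ^ 2 + 2 * a + 3) = (a ^ 2 + 2 * a + 3) * w ^ 2 := by
    have : a ^ 2 + 2 * a + 3 ≠ 0 := by positivity
    rw [← hwn]; field_simp
  have q1 := pow_le_pow_left₀ hr0 hr 2
  have q2 := pow_le_pow_left₀ hs0 hs 2
  have q3 := pow_le_pow_left₀ ht0 ht 2
  have r1 := mul_le_mul_of_nonneg_left hr ha0
  have r2 := mul_le_mul_of_nonneg_left hs ha0
  have r3 := mul_le_mul_of_nonneg_left ht ha0
  have haw0 : 0 ≤ a * w := mul_nonneg ha0 hw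
  have haw : a ^ 2 * w ≤ n := by linarith
  have haw' : 2 * (a * w) ≤ a ^ 2 * w := by
    have := mul_le_mul_of_nonneg_right ha haw0
    linarith
  have hww : 2 * w ≤ a * w := mul_le_mul_of_nonneg_right ha hw
  have ha2 : 2 * a ≤ a ^ 2 := by
    have := mul_le_mul_of_nonneg_right ha ha0
    linarith
  have haa : a ^ 2 * 1 ≤ a ^ 2 * n := mul_le_mul_of_nonneg_left hn (sq_nonneg a)
  have han : 1 * n ≤ a ^ 2 * n := mul_le_mul_of_nonneg_right (by linarith) (by linarith)
  rw [hsq]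
  linarith

lemma card_monoTriples_redBlueRed_le {a n : ℕ} (ha : 2 ≤ a) (hn : 1 ≤ n) :
    2 * a * ((monoTriples a n (redBlueRed a n)).card : ℝ) ≤
      (n : ℝ) ^ 2 / (a ^ 2 + 2 * a + 3) + 20 * a ^ 2 * n := by
  set A := (a + 1) * n / (a ^ 2 + 2 * a + 3) with hA
  set B := (a ^ 2 + 2 * a + 2) * n / (a ^ 2 + 2 * a + 3) with hB
  have ha1 : 1 ≤ a := by omega
  set T := monoTriples a n (redBlueRed a n) with hT
  -- Blue triples lie wholly in the middle block. A red triple with z beyond the first block has z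
  -- in the last one, and then x cannot be in the first.
  have hcover : T ⊆ (T.filter fun t => (t.2.2 : ℕ) ≤ A) ∪
      (T.filter fun t => A < (t.1 : ℕ) ∧ A < (t.2.1 : ℕ) ∧ (t.2.2 : ℕ) ≤ B) ∪
      (T.filter fun t => B < (t.1 : ℕ)) := by
    rintro ⟨x, y, z⟩ h
    obtain ⟨h1, h2, h3⟩ := mem_monoTriples.1 h
    have hx := redBlueRed_eq_true_iff (a := a) x
    have hy := redBlueRed_eq_true_iff (a := a) y
    have hz := redBlueRed_eq_true_iff (a := a) z
    rw [← hA, ← hB] at hx hy hz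
    have hx0 := (Finset.mem_Icc.1 x.2).1
    have hzn := (Finset.mem_Icc.1 z.2).2
    simp only at h1 h2 h3
    simp only [Finset.mem_union, Finset.mem_filter, h, true_and]
    by_contra hcon
    push Not at hcon
    obtain ⟨⟨c1, c2⟩, c3⟩ := hcon
    rw [h2] at hx
    rw [← h3] at hz
    by_cases hr : redBlueRed a n y = true
    · have rx := hx.1 hr
      have ry := hy.1 hr
      have rz := hz.1 hr
      refine redBlueRed_no_mixed ha hx0 (rx.resolve_right (by omega)) ry ?_ (h1 ▸ hzn)
      rw [h1]
      exact rz.resolve_left (by omega)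
    · have rx := mt hx.2 hr
      have ry := mt hy.2 hr
      have rz := mt hz.2 hr
      omega
  have e1 : (T.filter fun t => (t.2.2 : ℕ) ≤ A).card ≤ (trianglePairs a A).card := by
    refine card_le_card_trianglePairs ha1 0 0 A _ fun t ht => ?_
    obtain ⟨h, h'⟩ := Finset.mem_filter.1 ht
    exact ⟨(mem_monoTriples.1 h).1, (Finset.mem_Icc.1 t.1.2).1, (Finset.mem_Icc.1 t.2.1.2).1,
      by simpa using h'⟩
  have e2 : (T.filter fun t => A < (t.1 : ℕ) ∧ A < (t.2.1 : ℕ) ∧ (t.2.2 : ℕ) ≤ B).card ≤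
      (trianglePairs a (B - (A + a * A))).card := by
    refine card_le_card_trianglePairs ha1 A A _ _ fun t ht => ?_
    obtain ⟨h, h1, h2, h3⟩ := Finset.mem_filter.1 ht
    exact ⟨(mem_monoTriples.1 h).1, h1, h2, by omega⟩
  have e3 : (T.filter fun t => B < (t.1 : ℕ)).card ≤ (trianglePairs a (n - B)).card := by
    refine card_le_card_trianglePairs ha1 B 0 _ _ fun t ht => ?_
    obtain ⟨h, h'⟩ := Finset.mem_filter.1 ht
    have hzn := (Finset.mem_Icc.1 t.2.2.2).2
    exact ⟨(mem_monoTriples.1 h).1, h', (Finset.mem_Icc.1 t.2.1.2).1, by omega⟩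
  have htot : T.card ≤ (trianglePairs a A).card + (trianglePairs a (B - (A + a * A))).card +
      (trianglePairs a (n - B)).card :=
    (Finset.card_le_card hcover).trans ((Finset.card_union_le _ _).trans
      (add_le_add ((Finset.card_union_le _ _).trans (add_le_add e1 e2)) e3))
  have htotR : (T.card : ℝ) ≤ (trianglePairs a A).card +
      (trianglePairs a (B - (A + a * A))).card + (trianglePairs a (n - B)).card := by
    exact_mod_cast htot
  have haR : (2 : ℝ) ≤ a := by exact_mod_cast ha
  have hnR : (1 : ℝ) ≤ n := by exact_mod_cast hn
  have hD : (0 : ℝ) < a ^ 2 + 2 * a + 3 := by positivity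
  obtain ⟨w, hw⟩ : ∃ w : ℝ, w = n / (a ^ 2 + 2 * a + 3) := ⟨_, rfl⟩
  have hwD : w * (a ^ 2 + 2 * a + 3) = n := by rw [hw]; field_simp
  have hw0 : 0 ≤ w := by rw [hw]; positivity
  have hAle : (A : ℝ) ≤ (a + 1) * w := by
    have := Nat.cast_div_le (α := ℝ) (m := (a + 1) * n) (n := a ^ 2 + 2 * a + 3)
    push_cast at this
    rwa [mul_div_assoc, ← hw] at this
  have hBle : (B : ℝ) ≤ n - w := by
    have := Nat.cast_div_le (α := ℝ) (m := (a ^ 2 + 2 * a + 2) * n) (n := a ^ 2 + 2 * a + 3)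
    push_cast at this
    rw [mul_div_assoc, ← hw] at this
    linarith
  have hAge : (a + 1) * w - 1 ≤ (A : ℝ) := by
    have h : (a + 1) * n < (a ^ 2 + 2 * a + 3) * (A + 1) := Nat.lt_mul_div_succ _ (by positivity)
    have h' : ((a : ℝ) + 1) * n < (a ^ 2 + 2 * a + 3) * (A + 1) := by exact_mod_cast h
    rw [← hwD] at h'
    have : ((a : ℝ) + 1) * w < A + 1 :=
      lt_of_mul_lt_mul_left (by linarith) hD.le
    linarith
  have hBge : n - w - 1 ≤ (B : ℝ) := by
    have h : (a ^ 2 + 2 * a + 2) * n < (a ^ 2 + 2 * a + 3) * (B + 1) :=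
      Nat.lt_mul_div_succ _ (by positivity)
    have h' : ((a : ℝ) ^ 2 + 2 * a + 2) * n < (a ^ 2 + 2 * a + 3) * (B + 1) := by exact_mod_cast h
    have : (n : ℝ) - w < B + 1 := by
      refine lt_of_mul_lt_mul_left ?_ hD.le
      linarith
    linarith
  -- Before rounding, the size is n - w - (a+1)²w = w; rounding A down adds at most a+1.
  have hs2 : ((B - (A + a * A) : ℕ) : ℝ) ≤ w + (a + 1) := by
    rcases le_total (A + a * A) B with h | h
    · rw [Nat.cast_sub h]
      push_cast
      have := mul_le_mul_of_nonneg_left hAge (by linarith : (0 : ℝ) ≤ a + 1)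
      linarith
    · rw [Nat.sub_eq_zero_of_le h, Nat.cast_zero]
      positivity
  have hs3 : ((n - B : ℕ) : ℝ) ≤ w + (a + 1) := by
    have hBn : B ≤ n := by
      have : (B : ℝ) ≤ n := by linarith
      exact_mod_cast this
    rw [Nat.cast_sub hBn]
    linarith
  have t1 := card_trianglePairs_le a A
  have t2 := card_trianglePairs_le a (B - (A + a * A))
  have t3 := card_trianglePairs_le a (n - B)
  have h2 := mul_le_mul_of_nonneg_left htotR (by linarith : (0 : ℝ) ≤ 2 * a)
  have := three_triangles_le haR hnR hw0 hwD (Nat.cast_nonneg _) hAle (Nat.cast_nonneg _) hs2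
    (Nat.cast_nonneg _) hs3
  linarith

/-! ### The asymptotic formula -/

theorem mainTheorem1 (a : ℕ) (ha : 2 ≤ a) :
    ((fun n : ℕ => (minMonoTriples a n : ℝ) -
        (n : ℝ) ^ 2 / (2 * (a : ℝ) * ((a : ℝ) ^ 2 + 2 * (a : ℝ) + 3)))
      =O[atTop] fun n : ℕ => (n : ℝ)) ∧
    ((fun n : ℕ => ((monoTriples a n (redBlueRed a n)).card : ℝ) -
        (n : ℝ) ^ 2 / (2 * (a : ℝ) * ((a : ℝ) ^ 2 + 2 * (a : ℝ) + 3)))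
      =O[atTop] fun n : ℕ => (n : ℝ)) := by
  have haR : (2 : ℝ) ≤ a := by exact_mod_cast ha
  have hscale : ∀ n : ℕ, (n : ℝ) ^ 2 / (a ^ 2 + 2 * a + 3) =
      2 * a * ((n : ℝ) ^ 2 / (2 * (a : ℝ) * ((a : ℝ) ^ 2 + 2 * (a : ℝ) + 3))) := fun n => by
    field_simp
  have lower : ∀ n : ℕ, 1 ≤ n → ∀ c : TwoColoring n,
      -(10 * a * n : ℝ) ≤ ((monoTriples a n c).card : ℝ) -
        (n : ℝ) ^ 2 / (2 * (a : ℝ) * ((a : ℝ) ^ 2 + 2 * (a : ℝ) + 3)) := by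
    intro n hn c
    have h := configSum_lower_bound (abs_colorSign c) ha hn
    rw [← four_mul_card_monoTriples (by omega) c, mul_div_assoc, hscale] at h
    refine le_of_mul_le_mul_left ?_ (by linarith : (0 : ℝ) < 4 * a)
    linarith
  have upper : ∀ n : ℕ, 1 ≤ n → ((monoTriples a n (redBlueRed a n)).card : ℝ) -
      (n : ℝ) ^ 2 / (2 * (a : ℝ) * ((a : ℝ) ^ 2 + 2 * (a : ℝ) + 3)) ≤ 10 * a * n := by
    intro n hn
    have h := card_monoTriples_redBlueRed_le ha hn
    rw [hscale] at h
    refine le_of_mul_le_mul_left ?_ (by linarith : (0 : ℝ) < 2 * a)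
    linarith
  constructor
  · refine IsBigO.of_bound (10 * a) ?_
    filter_upwards [eventually_ge_atTop 1] with n hn
    rw [Real.norm_eq_abs, Real.norm_natCast, abs_le]
    obtain ⟨c, -, hc⟩ := Finset.exists_mem_eq_inf' Finset.univ_nonempty
      fun c : TwoColoring n => (monoTriples a n c).card
    have hmin : minMonoTriples a n = (monoTriples a n c).card := hc
    have hle : minMonoTriples a n ≤ (monoTriples a n (redBlueRed a n)).card :=
      Finset.inf'_le _ (Finset.mem_univ _)
    have hleR : (minMonoTriples a n : ℝ) ≤ (monoTriples a n (redBlueRed a n)).card := by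
      exact_mod_cast hle
    refine ⟨hmin ▸ lower n hn c, ?_⟩
    linarith [upper n hn]
  · refine IsBigO.of_bound (10 * a) ?_
    filter_upwards [eventually_ge_atTop 1] with n hn
    rw [Real.norm_eq_abs, Real.norm_natCast, abs_le]
    exact ⟨lower n hn _, upper n hn⟩
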